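/- **Setting.** Let $M$ be a compact connected smooth Riemannian manifold of nonpositive sectional curvature and of rank one (some unit-speed geodesic $c$ has the property that every parallel Jacobi field along it is a multiple of $c'$). Let $X=\tilde M$ be its universal Riemannian covering with the Riemannian distance $d$, $SX$ the unit tangent bundle, $\pi:SX\to X$ the projection and $g^t$ the geodesic flow on $SX$. Write $v\sim w$ if $d(\pi g^tv,\pi g^tw)$ is bounded for $t>0$; let $X(\infty)=SX/{\sim}$ with the quotient topology and its Borel $\sigma$-algebra, let $v_\infty$ be the class of $v$ and $v_{-\infty}:=(-v)_\infty$. Let $b(p,q,\xi)=\lim_{p_t\to\xi}\bigl(d(q,p_t)-d(p,p_t)\bigr)$ be the Busemann function. The stable and unstable horospheres are $$W^s(v)=\{w: w_\infty=v_\infty,\ b(\pi v,\pi w,v_\infty)=0\},\qquad W^u(v)=\{w: w_{-\infty}=v_{-\infty},\ b(\pi v,\pi w,v_{-\infty})=0\},$$ and $W^{0s}(v)=\bigcup_t g^tW^s(v)$, $W^{0u}(v)=\bigcup_t g^tW^u(v)$. Let $h\in\mathbb R$ (in the application, $h$ is the topological entropy of the geodesic flow) and let $(\mu_p)_{p\in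 X}$ be an $h$-dimensional Busemann density: finite nonzero Borel measures on $X(\infty)$ with $\mu_{\gamma p}(\gamma S)=\mu_p(S)$ for all deck transformations $\gamma$ and measurable $S$, with $\mu_p\ll\mu_q$ and $\frac{d\mu_p}{d\mu_q}(\xi)=e^{-hb(q,p,\xi)}$ for $\mu_q$-almost every $\xi$, for all $p,q\in X$. Define $$dm^u_v(w)=e^{-hb(\pi v,\pi w,w_\infty)}\,d\mu_{\pi v}(w_\infty),\qquad dm^s_v(w)=e^{-hb(\pi v,\pi w,w_{-\infty})}\,d\mu_{\pi v}(w_{-\infty}),$$ $dm^{0u}_v=dm^u_v\,dt$ and $dm^{0s}_v=dm^s_v\,dt$; explicitly, for $A,B\subset SX$, $$m^u_v(A)=\int_{X(\infty)}\ \sum_{w\in A,\ w_\infty=\xi}e^{-hb(\pi v,\pi w,\xi)}\,d\mu_{\pi v}(\xi),\qquad m^{0u}_v(B)=\int_{X(\infty)}\ \sum_{\ell}\ \int_{\{w\in\ell\cap B:\ w_\infty=\xi\}}e^{-hb(\pi v,\pi w,\xi)}\,dt\ d\mu_{\pi v}(\xi),$$ where $\ell$ runs over the flow lines of $g$ and $dt$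 is Lebesgue measure of the time parameter on $\ell$; $m^s_v$ and $m^{0s}_v$ are defined in the same way with $w_{-\infty}$ in place of $w_\infty$. **Theorem (holonomy invariance of the conditionals).** (1) Let $v'\in W^s(v)$, let $A\subset W^{0u}(v)$ and $A'\subset W^{0u}(v')$, and let $H:A\to A'$ be a bijection with $H(w)\in W^s(w)$ for all $w\in A$. Then $m^u_v(A)=m^u_{v'}(A')$; that is, $dm^u_v(w)=dm^u_{v'}(w')$ whenever $v'\in W^s(v)$, $w'\in W^s(w)$, $w\in W^{0u}(v)$, $w'\in W^{0u}(v')$. If moreover $H$ respects the flow direction, i.e. for all $w_1,w_2\in A$ and $t\in\mathbb R$ one has $w_2=g^tw_1$ if and only if $H(w_2)=g^tH(w_1)$, then $m^{0u}_v(A)=m^{0u}_{v'}(A')$. (2) Let $v'\in W^u(v)$, let $A\subset W^{0s}(v)$ and $A'\subset W^{0s}(v')$, and let $H:A\to A'$ be a bijection with $H(w)\in W^u(w)$ for all $w\in A$. Then $m^s_v(A)=m^s_{v'}(A')$; that is, $dm^s_v(w)=dm^s_{v'}(w')$ whenever $v'\in W^u(v)$, $w'\in W^u(w)$, $w\in W^{0s}(v)$,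 $w'\in W^{0s}(v')$. If moreover $H$ respects the flow direction, then $m^{0s}_v(A)=m^{0s}_{v'}(A')$. -/

import Mathlib

open Set Filter Topology MeasureTheory Bundle
open scoped Manifold ContDiff ENNReal

noncomputable section

namespace RankOne

/-! ### Riemannian geometry in charts -/

section Geometry

variable {n : ℕ} {X : Type*} [TopologicalSpace X] [ChartedSpace (EuclideanSpace ℝ (Fin n)) X]
  [RiemannianBundle (fun x : X => TangentSpace (𝓡 n) x)]

/-- The `i`-th coordinate vector field of the chart at `x₀`, at the point with coordinates `y`. -/
def coordVec (x₀ : X) (y : EuclideanSpace ℝ (Fin n)) (i : Fin n) :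
    TangentSpace (𝓡 n) ((extChartAt (𝓡 n) x₀).symm y) :=
  mfderiv (𝓡 n) (𝓡 n) (extChartAt (𝓡 n) x₀).symm y (EuclideanSpace.single i (1 : ℝ))

/-- The matrix `g_{ij}` of the Riemannian metric in the chart at `x₀`. -/
def metricMatrix (x₀ : X) (y : EuclideanSpace ℝ (Fin n)) : Matrix (Fin n) (Fin n) ℝ :=
  Matrix.of fun i j => inner ℝ (coordVec x₀ y i) (coordVec x₀ y j)

/-- The partial derivative `∂_i f` of a function of the coordinates. -/
def partialDeriv (i : Fin n) (f : EuclideanSpace ℝ (Fin n) → ℝ)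
    (y : EuclideanSpace ℝ (Fin n)) : ℝ :=
  fderiv ℝ f y (EuclideanSpace.single i (1 : ℝ))

/-- The Christoffel symbol `Γ^k_{ij}` of the Levi-Civita connection in the chart at `x₀`. -/
def christoffel (x₀ : X) (k i j : Fin n) (y : EuclideanSpace ℝ (Fin n)) : ℝ :=
  (1 / 2 : ℝ) * ∑ l, (metricMatrix x₀ y)⁻¹ k l *
    (partialDeriv i (fun z => metricMatrix x₀ z j l) y
      + partialDeriv j (fun z => metricMatrix x₀ z i l) y
      - partialDeriv l (fun z => metricMatrix x₀ z i j) y)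

/-- The component `R^l_{kij}` of the curvature tensor in the chart at `x₀`:
`R(∂_i, ∂_j) ∂_k = ∑ l, R^l_{kij} ∂_l`,
where `R(U, V) = ∇_U ∇_V - ∇_V ∇_U - ∇_{[U, V]}`. -/
def curvature (x₀ : X) (l k i j : Fin n) (y : EuclideanSpace ℝ (Fin n)) : ℝ :=
  partialDeriv i (christoffel x₀ l j k) y - partialDeriv j (christoffel x₀ l i k) y
    + ∑ m, (christoffel x₀ l i m y * christoffel x₀ m j k y
        - christoffel x₀ l j m y * christoffel x₀ m i k y)

variable (n X) in
/-- All sectional curvatures are nonpositive: `⟨R(u, w) w, u⟩ ≤ 0` for all tangent vectors `u, w`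
at a common point. -/
def NonposCurvature : Prop :=
  ∀ (x₀ : X), ∀ y ∈ (extChartAt (𝓡 n) x₀).target, ∀ u w : Fin n → ℝ,
    ∑ i, ∑ j, ∑ k, ∑ l, ∑ p,
      curvature x₀ l k i j y * metricMatrix x₀ y l p * u i * w j * w k * u p ≤ 0

/-- The coordinates of the curve `c` in the chart at `x₀`. -/
def coordCurve (c : ℝ → X) (x₀ : X) (k : Fin n) (s : ℝ) : ℝ :=
  extChartAt (𝓡 n) x₀ (c s) k

/-- The velocity vector `c'(t)`. -/
def velocity (c : ℝ → X) (t : ℝ) : TangentSpace (𝓡 n) (c t) :=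
  mfderiv 𝓘(ℝ, ℝ) (𝓡 n) c t (1 : ℝ)

variable (n) in
/-- `c : ℝ → X` is a (complete) geodesic parameterized by arclength. The geodesic equation is
required in all charts of the atlas around the point in question. -/
structure IsUnitSpeedGeodesic (c : ℝ → X) : Prop where
  smooth : ContMDiff 𝓘(ℝ, ℝ) (𝓡 n) ∞ c
  unit_speed : ∀ t, ‖velocity (n := n) c t‖ = 1
  geodesic_eq : ∀ (x₀ : X) (t : ℝ), c t ∈ (chartAt (EuclideanSpace ℝ (Fin n)) x₀).source →
    ∀ k : Fin n, deriv (deriv (coordCurve c x₀ k)) t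
      + ∑ i, ∑ j, christoffel x₀ k i j (extChartAt (𝓡 n) x₀ (c t))
          * deriv (coordCurve c x₀ i) t * deriv (coordCurve c x₀ j) t = 0

/-- The coordinates, in the chart at `x₀`, of a vector field `J` along `c`. -/
def coordField {c : ℝ → X} (J : ∀ t, TangentSpace (𝓡 n) (c t)) (x₀ : X) (k : Fin n) (s : ℝ) : ℝ :=
  (show EuclideanSpace ℝ (Fin n) from
    mfderiv (𝓡 n) (𝓡 n) (extChartAt (𝓡 n) x₀) (c s) (J s)) k

/-- The vector field `K` along `c` is the covariant derivative of the vector field `J`. -/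
def HasCovDeriv {c : ℝ → X} (J K : ∀ t, TangentSpace (𝓡 n) (c t)) : Prop :=
  ∀ (x₀ : X) (t : ℝ), c t ∈ (chartAt (EuclideanSpace ℝ (Fin n)) x₀).source →
    ∀ k : Fin n, HasDerivAt (coordField J x₀ k)
      (coordField K x₀ k t - ∑ i, ∑ j, christoffel x₀ k i j (extChartAt (𝓡 n) x₀ (c t))
          * deriv (coordCurve c x₀ i) t * coordField J x₀ j t) t

/-- `J` is a Jacobi field along `c`: `J'' + R(J, c') c' = 0`. -/
def IsJacobiField {c : ℝ → X} (J : ∀ t, TangentSpace (𝓡 n) (c t)) : Prop :=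
  ∃ K L : ∀ t, TangentSpace (𝓡 n) (c t), HasCovDeriv J K ∧ HasCovDeriv K L ∧
    ∀ (x₀ : X) (t : ℝ), c t ∈ (chartAt (EuclideanSpace ℝ (Fin n)) x₀).source →
      ∀ l : Fin n, coordField L x₀ l t
        + ∑ i, ∑ j, ∑ k, curvature x₀ l k i j (extChartAt (𝓡 n) x₀ (c t))
            * coordField J x₀ i t * deriv (coordCurve c x₀ j) t * deriv (coordCurve c x₀ k) t = 0

variable (n X) in
/-- The manifold has rank one: along some geodesic `c` the space of parallel Jacobi fields, which
always contains `c'`, is one-dimensional. -/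
def IsRankOne : Prop :=
  ∃ c : ℝ → X, IsUnitSpeedGeodesic n c ∧ ∀ J : ∀ t, TangentSpace (𝓡 n) (c t),
    HasCovDeriv J (fun _ => 0) → IsJacobiField J → ∃ a : ℝ, ∀ t, J t = a • velocity (n := n) c t

variable (n X) in
/-- The unit tangent bundle. -/
def UnitTangent : Type _ := {v : TangentBundle (𝓡 n) X // ‖v.2‖ = 1}

namespace UnitTangent

/-- The base point. -/
def base (v : UnitTangent n X) : X := v.1.1

/-- The opposite vector, `v ↦ -v`. -/
instance : Neg (UnitTangent n X) :=
  ⟨fun v => ⟨⟨v.1.1, -v.1.2⟩, by rw [norm_neg]; exact v.2⟩⟩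

instance [IsManifold (𝓡 n) 1 X] : TopologicalSpace (UnitTangent n X) :=
  inferInstanceAs (TopologicalSpace {v : TangentBundle (𝓡 n) X // ‖v.2‖ = 1})

end UnitTangent

/-- The tangent vector `c'(t)` of a unit speed geodesic as a point of the unit tangent bundle. -/
def IsUnitSpeedGeodesic.tangent {c : ℝ → X} (hc : IsUnitSpeedGeodesic n c) (t : ℝ) :
    UnitTangent n X :=
  ⟨⟨c t, velocity c t⟩, hc.unit_speed t⟩

open Classical in
/-- The geodesic flow: `g^t v = c_v'(t)`, where `c_v` is the geodesic with `c_v'(0) = v`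
(which exists on a complete manifold, and is unique). -/
def geodesicFlow (t : ℝ) (v : UnitTangent n X) : UnitTangent n X :=
  if h : ∃ c : ℝ → X, ∃ hc : IsUnitSpeedGeodesic n c, hc.tangent 0 = v
  then h.choose_spec.choose.tangent t else v

/-- A flow line (orbit) of the geodesic flow. -/
def FlowLine (n : ℕ) (X : Type*) [TopologicalSpace X]
    [ChartedSpace (EuclideanSpace ℝ (Fin n)) X]
    [RiemannianBundle (fun x : X => TangentSpace (𝓡 n) x)] : Type _ :=
  Quot (fun v w : UnitTangent n X => ∃ t : ℝ, geodesicFlow t v = w)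

/-- `proj : X → M` exhibits `X` as a Riemannian covering of `M`: it is a surjective smooth covering
map and a local isometry. -/
structure IsRiemannianCovering (n : ℕ) {X M : Type*}
    [TopologicalSpace X] [ChartedSpace (EuclideanSpace ℝ (Fin n)) X]
    [RiemannianBundle (fun x : X => TangentSpace (𝓡 n) x)]
    [TopologicalSpace M] [ChartedSpace (EuclideanSpace ℝ (Fin n)) M]
    [RiemannianBundle (fun x : M => TangentSpace (𝓡 n) x)] (proj : X → M) : Prop where
  covering : IsCoveringMap proj
  surjective : Function.Surjective proj
  smooth : ContMDiff (𝓡 n) (𝓡 n) ∞ proj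
  isometric : ∀ (x : X) (v : TangentSpace (𝓡 n) x), ‖mfderiv (𝓡 n) (𝓡 n) proj x v‖ = ‖v‖

end Geometry

/-! ### The boundary at infinity, Busemann functions, horospheres

From here on `X` plays the role of the universal covering with its Riemannian distance. -/

section Boundary

variable {n : ℕ} {X : Type*} [MetricSpace X] [ChartedSpace (EuclideanSpace ℝ (Fin n)) X]
  [RiemannianBundle (fun x : X => TangentSpace (𝓡 n) x)]

/-- `v ∼ w`: the vectors `v, w` are positively asymptotic. -/
def Asymptotic (v w : UnitTangent n X) : Prop :=
  ∃ C : ℝ, ∀ t : ℝ, 0 < t → dist (geodesicFlow t v).base (geodesicFlow t w).base < C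

variable (n X) in
/-- Being positively asymptotic is an equivalence relation. -/
def asymptoticSetoid : Setoid (UnitTangent n X) where
  r := Asymptotic
  iseqv :=
    { refl := fun v => ⟨1, fun t _ => by rw [dist_self]; exact one_pos⟩
      symm := fun ⟨C, hC⟩ => ⟨C, fun t ht => by rw [dist_comm]; exact hC t ht⟩
      trans := fun ⟨C, hC⟩ ⟨D, hD⟩ => ⟨C + D, fun t ht =>
        (dist_triangle _ _ _).trans_lt (add_lt_add (hC t ht) (hD t ht))⟩ }

variable (n X) in
/-- The boundary at infinity `X(∞) = SX / ∼`. -/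
def Boundary : Type _ := Quotient (asymptoticSetoid n X)

/-- The quotient topology; on a Hadamard manifold it is the cone topology. -/
instance [IsManifold (𝓡 n) 1 X] : TopologicalSpace (Boundary n X) :=
  inferInstanceAs (TopologicalSpace (Quotient (asymptoticSetoid n X)))

instance [IsManifold (𝓡 n) 1 X] : MeasurableSpace (Boundary n X) := borel _

instance [IsManifold (𝓡 n) 1 X] : BorelSpace (Boundary n X) := ⟨rfl⟩

/-- The forward endpoint `v_∞`. -/
def endpointPlus (v : UnitTangent n X) : Boundary n X := Quotient.mk (asymptoticSetoid n X) v

/-- The backward endpoint `v_{-∞}`. -/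
def endpointMinus (v : UnitTangent n X) : Boundary n X := endpointPlus (-v)

/-- The Busemann function `b(p, q, ξ) = lim (d(q, p_t) - d(p, p_t))` as `p_t → ξ`, the limit being
taken along a geodesic ray `p_t` in the class `ξ`. On a Hadamard manifold this limit exists, so that
it is the `limsup`, and it does not depend on the way in which `p_t` tends to `ξ`. -/
def busemann (p q : X) (ξ : Boundary n X) : ℝ :=
  limsup (fun t : ℝ => dist q (geodesicFlow t (Quotient.out ξ)).base
    - dist p (geodesicFlow t (Quotient.out ξ)).base) atTop

/-- The stable horosphere `W^s(v)`, the unit normal bundle (on the side of `v_∞`) of the level set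
`b(πv, ·, v_∞) = 0`: all `w` with `w_∞ = v_∞` and base point in that level set. -/
def stableLeaf (v : UnitTangent n X) : Set (UnitTangent n X) :=
  {w | Asymptotic w v ∧ busemann v.base w.base (endpointPlus v) = 0}

/-- The unstable horosphere `W^u(v)`: all `w` with `w_{-∞} = v_{-∞}` and
`b(πv, πw, v_{-∞}) = 0`. -/
def unstableLeaf (v : UnitTangent n X) : Set (UnitTangent n X) :=
  {w | Asymptotic (-w) (-v) ∧ busemann v.base w.base (endpointMinus v) = 0}

/-- The weakly stable leaf `W^{0s}(v)`: the union of the flow lines through `W^s(v)`. -/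
def weakStableLeaf (v : UnitTangent n X) : Set (UnitTangent n X) :=
  {w | ∃ u ∈ stableLeaf v, ∃ t : ℝ, w = geodesicFlow t u}

/-- The weakly unstable leaf `W^{0u}(v)`: the union of the flow lines through `W^u(v)`. -/
def weakUnstableLeaf (v : UnitTangent n X) : Set (UnitTangent n X) :=
  {w | ∃ u ∈ unstableLeaf v, ∃ t : ℝ, w = geodesicFlow t u}

/-- The image of a subset of the boundary under a deck transformation `γ`, where `γ` maps the
endpoint of a geodesic `c` to the endpoint of `γ ∘ c`. -/
def deckImage (γ : X ≃ₜ X) (S : Set (Boundary n X)) : Set (Boundary n X) :=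
  {η | ∃ v w : UnitTangent n X, endpointPlus v ∈ S ∧ endpointPlus w = η ∧
    ∀ t : ℝ, (geodesicFlow t w).base = γ (geodesicFlow t v).base}

/-- `μ` is an `h`-dimensional Busemann density (conformal density) on the boundary of the covering
`proj : X → M`. -/
structure IsBusemannDensity [IsManifold (𝓡 n) 1 X] {M : Type*} (proj : X → M) (h : ℝ)
    (μ : X → Measure (Boundary n X)) : Prop where
  finite : ∀ p, IsFiniteMeasure (μ p)
  ne_zero : ∀ p, μ p ≠ 0
  equivariant : ∀ γ : X ≃ₜ X, (∀ x, proj (γ x) = proj x) → ∀ p, ∀ S : Set (Boundary n X),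
    MeasurableSet S → μ (γ p) (deckImage γ S) = μ p S
  absolutelyContinuous : ∀ p q, μ p ≪ μ q
  rnDeriv_eq : ∀ p q, (μ p).rnDeriv (μ q) =ᵐ[μ q]
    fun ξ => ENNReal.ofReal (Real.exp (-h * busemann q p ξ))

/-! ### The conditionals -/

/-- The measure of `A` for the density `e^{-h b(πv, πw, e(w))} dμ_{πv}(e(w))`, where `e` is one of
the two endpoint maps: `A` is parameterized by `e`, points being counted with multiplicity. So, if
`e` is injective on `A`, this is the integral over `ξ ∈ e(A)` of `e^{-h b(πv, πw, ξ)}` with respect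
to `μ_{πv}`, where `w` is the point of `A` with `e(w) = ξ`. -/
def condMeasure [IsManifold (𝓡 n) 1 X] (e : UnitTangent n X → Boundary n X) (h : ℝ)
    (μ : X → Measure (Boundary n X)) (v : UnitTangent n X) (A : Set (UnitTangent n X)) : ℝ≥0∞ :=
  ∫⁻ ξ, ∑' w : {w : UnitTangent n X // w ∈ A ∧ e w = ξ},
    ENNReal.ofReal (Real.exp (-h * busemann v.base w.1.base ξ)) ∂(μ v.base)

/-- The measure of `B` for the density `e^{-h b(πv, πw, e(w))} dμ_{πv}(e(w)) dt`: as
`condMeasure`, but on the flow lines that make up a fiber of `e` one integrates with respect to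
time `dt` instead of counting points. -/
def condMeasureFlow [IsManifold (𝓡 n) 1 X] (e : UnitTangent n X → Boundary n X) (h : ℝ)
    (μ : X → Measure (Boundary n X)) (v : UnitTangent n X) (B : Set (UnitTangent n X)) : ℝ≥0∞ :=
  ∫⁻ ξ, ∑' l : FlowLine n X, (∫⁻ t : ℝ,
    {w : UnitTangent n X | w ∈ B ∧ e w = ξ}.indicator
      (fun w => ENNReal.ofReal (Real.exp (-h * busemann v.base w.base ξ)))
      (geodesicFlow t (Quot.out l))) ∂(μ v.base)

variable [IsManifold (𝓡 n) 1 X] (h : ℝ) (μ : X → Measure (Boundary n X))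

/-- `m^u_v`, given by `dm^u_v(w) = e^{-h b(πv, πw, w_∞)} dμ_{πv}(w_∞)`. -/
def mU (v : UnitTangent n X) (A : Set (UnitTangent n X)) : ℝ≥0∞ :=
  condMeasure endpointPlus h μ v A

/-- `m^s_v`, given by `dm^s_v(w) = e^{-h b(πv, πw, w_{-∞})} dμ_{πv}(w_{-∞})`. -/
def mS (v : UnitTangent n X) (A : Set (UnitTangent n X)) : ℝ≥0∞ :=
  condMeasure endpointMinus h μ v A

/-- `m^{0u}_v`, given by `dm^{0u}_v = dm^u_v dt`. -/
def mWeakU (v : UnitTangent n X) (B : Set (UnitTangent n X)) : ℝ≥0∞ :=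
  condMeasureFlow endpointPlus h μ v B

/-- `m^{0s}_v`, given by `dm^{0s}_v = dm^s_v dt`. -/
def mWeakS (v : UnitTangent n X) (B : Set (UnitTangent n X)) : ℝ≥0∞ :=
  condMeasureFlow endpointMinus h μ v B

end Boundary

/-- `H` is a holonomy along the leaves `W` from the piece `A` onto the piece `A'`. -/
structure IsHolonomy {S : Type*} (W : S → Set S) (H : S → S) (A A' : Set S) : Prop where
  bijOn : BijOn H A A'
  mem_leaf : ∀ w ∈ A, H w ∈ W w

/-- On the piece `B`, the map `H` respects the flow direction: it maps points on the same flow line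
to points on the same flow line, with the same time difference, and conversely. -/
def RespectsFlow {S : Type*} (g : ℝ → S → S) (H : S → S) (B : Set S) : Prop :=
  ∀ w₁ ∈ B, ∀ w₂ ∈ B, ∀ t : ℝ, w₂ = g t w₁ ↔ H w₂ = g t (H w₁)

end RankOne

end

/-!
On the unit vectors with a given endpoint `ξ`, the density `e^{-h b(p, w, ξ)} dμ_p(ξ)` does not
depend on `p`: a change of `p` multiplies `μ_p` by the Radon–Nikodym derivative
`e^{-h b(p, p', ξ)}`, and the cocycle identity `b(p, w, ξ) = b(p, p', ξ) + b(p', w, ξ)` shows that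
the exponential factor changes by the inverse amount. The same identity shows that the density does
not change if `w` slides along a horosphere at `ξ`, where `b(w, w', ξ) = 0`
(`weight_eq_mul_weight`). A holonomy preserves the endpoint and moves points along horospheres.
So it matches the integrands defining the conditionals for almost every `ξ`.

The cocycle identity, multiplied by `h`, is obtained almost everywhere from the density itself
(`IsBusemannDensity.ae_cocycle`), by the chain rule for Radon–Nikodym derivatives. The identity
holds outside one null set for all base points at once, because Busemann functions are Lipschitz
in the base points and a countable dense set of base points suffices. No comparison geometry is
needed to make the limits defining `b` converge.

For the conditionals on weak leaves one also needs that the geodesic flow is an action of `ℝ`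
(`geodesicFlow_zero`, `geodesicFlow_add`). This rests on the uniqueness of geodesics
(`IsUnitSpeedGeodesic.eq_of_tangent_eq`), that is on the uniqueness theorem for ordinary
differential equations applied in charts, where the Christoffel symbols are smooth. The time
integral over a flow line then does not depend on the representative, and a map that respects the
flow direction induces a bijection of flow lines preserving these integrals
(`tsum_lintegral_flowLine_eq`).
-/

namespace RankOne

/-! ### Smoothness of the Christoffel symbols -/

section MatrixSmoothness

variable {E : Type*} [NormedAddCommGroup E] [NormedSpace ℝ E] {m : WithTop ℕ∞} {n : ℕ}

lemma contDiffAt_matrix_det {A : E → Matrix (Fin n) (Fin n) ℝ} {y : E}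
    (hA : ∀ i j, ContDiffAt ℝ m (fun z => A z i j) y) :
    ContDiffAt ℝ m (fun z => (A z).det) y := by
  simp only [Matrix.det_apply']
  exact ContDiffAt.sum fun σ _ => contDiffAt_const.mul (contDiffAt_prod fun i _ => hA _ _)

/-- By Cramer's rule, the entries of the inverse are smooth where the determinant is nonzero. -/
lemma contDiffAt_matrix_inv {A : E → Matrix (Fin n) (Fin n) ℝ} {y : E}
    (hA : ∀ i j, ContDiffAt ℝ m (fun z => A z i j) y) (hdet : (A y).det ≠ 0) (i j : Fin n) :
    ContDiffAt ℝ m (fun z => (A z)⁻¹ i j) y := by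
  simp only [Matrix.inv_def, Ring.inverse_eq_inv', Matrix.smul_apply, smul_eq_mul,
    Matrix.adjugate_apply]
  refine ((contDiffAt_matrix_det hA).inv hdet).mul (contDiffAt_matrix_det fun k l => ?_)
  by_cases hk : k = j
  · subst hk
    simpa only [Matrix.updateRow_self] using contDiffAt_const
  · simpa only [Matrix.updateRow_ne hk] using hA k l

end MatrixSmoothness

section Christoffel

variable {n : ℕ} {X : Type*} [TopologicalSpace X] [ChartedSpace (EuclideanSpace ℝ (Fin n)) X]
  [IsManifold (𝓡 n) ∞ X]

lemma contMDiffOn_coordVec (x₀ : X) (i : Fin n) :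
    ContMDiffOn (𝓡 n) (𝓡 n).tangent ∞
      (fun y => (⟨(extChartAt (𝓡 n) x₀).symm y, coordVec x₀ y i⟩ : TangentBundle (𝓡 n) X))
      (extChartAt (𝓡 n) x₀).target := by
  have hopen : IsOpen (extChartAt (𝓡 n) x₀).target := isOpen_extChartAt_target x₀
  have h1 := (contMDiffOn_extChartAt_symm (I := 𝓡 n) (n := ∞) x₀).contMDiffOn_tangentMapWithin
    (m := ∞) (by simp) hopen.uniqueMDiffOn
  have h2 : ContMDiff (𝓡 n) (𝓡 n).tangent ∞
      (fun y : EuclideanSpace ℝ (Fin n) =>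
        (⟨y, EuclideanSpace.single i (1 : ℝ)⟩ : TangentBundle (𝓡 n) (EuclideanSpace ℝ (Fin n)))) :=
    contMDiff_vectorSpace_iff_contDiff.2 contDiff_const
  refine (h1.comp h2.contMDiffOn (fun y hy => hy)).congr fun y hy => ?_
  simp only [Function.comp_apply, tangentMapWithin, coordVec]
  rw [mfderivWithin_of_mem_nhds (hopen.mem_nhds hy)]

lemma mfderiv_extChartAt_symm_injective (x₀ : X) {y : EuclideanSpace ℝ (Fin n)}
    (hy : y ∈ (extChartAt (𝓡 n) x₀).target) :
    Function.Injective (mfderiv (𝓡 n) (𝓡 n) (extChartAt (𝓡 n) x₀).symm y) := by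
  have h := mfderiv_extChartAt_comp_mfderivWithin_extChartAt_symm (I := 𝓡 n) (x := x₀) hy
  rw [ModelWithCorners.range_eq_univ, mfderivWithin_univ] at h
  intro a b hab
  have ha := DFunLike.congr_fun h a
  have hb := DFunLike.congr_fun h b
  simp only [ContinuousLinearMap.comp_apply] at ha hb
  rw [hab] at ha
  exact ha.symm.trans hb

variable [RiemannianBundle (fun x : X => TangentSpace (𝓡 n) x)]

/-- The metric matrix is the Gram matrix of the linearly independent coordinate vectors. -/
lemma metricMatrix_det_ne_zero (x₀ : X) {y : EuclideanSpace ℝ (Fin n)}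
    (hy : y ∈ (extChartAt (𝓡 n) x₀).target) : (metricMatrix x₀ y).det ≠ 0 := by
  intro hdet
  obtain ⟨w, hw0, hw⟩ := Matrix.exists_mulVec_eq_zero_iff.2 hdet
  -- The squared length of the combination of coordinate vectors with coefficients `w` is `w · g w`.
  have hsum : ∑ i, w i • coordVec x₀ y i = 0 := by
    rw [← inner_self_eq_zero (𝕜 := ℝ), sum_inner]
    refine Finset.sum_eq_zero fun i _ => ?_
    have hi := congrFun hw i
    simp only [Matrix.mulVec, dotProduct, metricMatrix, Matrix.of_apply, Pi.zero_apply] at hi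
    rw [inner_smul_left, inner_sum]
    simp only [inner_smul_right]
    rw [Finset.sum_congr rfl fun j _ => mul_comm (w j) _, hi, mul_zero]
  let L : EuclideanSpace ℝ (Fin n) →L[ℝ] TangentSpace (𝓡 n) ((extChartAt (𝓡 n) x₀).symm y) :=
    mfderiv (𝓡 n) (𝓡 n) (extChartAt (𝓡 n) x₀).symm y
  have hL : L (∑ i, w i • EuclideanSpace.single i (1 : ℝ)) = 0 := by
    rw [← hsum, map_sum]
    exact Finset.sum_congr rfl fun i _ => map_smul _ _ _
  have h0 : ∑ i, w i • EuclideanSpace.single i (1 : ℝ) = 0 :=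
    mfderiv_extChartAt_symm_injective x₀ hy (hL.trans (map_zero L).symm)
  refine hw0 (funext fun k => ?_)
  have hk := congrArg (fun z : EuclideanSpace ℝ (Fin n) => z k) h0
  simpa [Pi.single_apply] using hk

variable [IsContMDiffRiemannianBundle (𝓡 n) ∞ (EuclideanSpace ℝ (Fin n))
      (fun x : X => TangentSpace (𝓡 n) x)]

lemma contDiffAt_metricMatrix (x₀ : X) {y : EuclideanSpace ℝ (Fin n)}
    (hy : y ∈ (extChartAt (𝓡 n) x₀).target) (i j : Fin n) :
    ContDiffAt ℝ ∞ (fun z => metricMatrix x₀ z i j) y := by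
  have h := (contMDiffOn_coordVec x₀ i).inner_bundle (contMDiffOn_coordVec x₀ j)
  exact (h.contMDiffAt ((isOpen_extChartAt_target x₀).mem_nhds hy)).contDiffAt

lemma contDiffAt_partialDeriv {f : EuclideanSpace ℝ (Fin n) → ℝ} {y : EuclideanSpace ℝ (Fin n)}
    (hf : ContDiffAt ℝ ∞ f y) (i : Fin n) : ContDiffAt ℝ ∞ (partialDeriv i f) y :=
  (hf.fderiv_right (m := ∞) (by simp)).clm_apply contDiffAt_const

lemma contDiffAt_christoffel (x₀ : X) {y : EuclideanSpace ℝ (Fin n)}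
    (hy : y ∈ (extChartAt (𝓡 n) x₀).target) (k i j : Fin n) :
    ContDiffAt ℝ ∞ (christoffel x₀ k i j) y := by
  have hg := contDiffAt_metricMatrix x₀ hy
  have hpart := fun a b c => contDiffAt_partialDeriv (hg a b) c
  exact contDiffAt_const.mul (ContDiffAt.sum fun l _ =>
    (contDiffAt_matrix_inv hg (metricMatrix_det_ne_zero x₀ hy) k l).mul
      (((hpart j l i).add (hpart i l j)).sub (hpart i j l)))

end Christoffel

/-! ### Uniqueness of geodesics -/

section Geodesics

variable {n : ℕ} {X : Type*} [TopologicalSpace X] [ChartedSpace (EuclideanSpace ℝ (Fin n)) X]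

lemma velocity_comp_add {c : ℝ → X} (hc : ContMDiff 𝓘(ℝ, ℝ) (𝓡 n) ∞ c) (s t : ℝ) :
    velocity (n := n) (fun r => c (r + s)) t = velocity (n := n) c (t + s) := by
  have hadd : HasMFDerivAt 𝓘(ℝ, ℝ) 𝓘(ℝ, ℝ) (fun r : ℝ => r + s) t (ContinuousLinearMap.id ℝ ℝ) :=
    ((hasFDerivAt_id t).add_const s).hasMFDerivAt
  have h := mfderiv_comp t (g := c) (f := fun r : ℝ => r + s)
    ((hc.contMDiffAt (x := t + s)).mdifferentiableAt (by simp)) hadd.mdifferentiableAt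
  rw [hadd.mfderiv] at h
  exact DFunLike.congr_fun h (1 : ℝ)

variable [IsManifold (𝓡 n) ∞ X]

lemma contDiffAt_extChartAt_comp {c : ℝ → X} (hc : ContMDiff 𝓘(ℝ, ℝ) (𝓡 n) ∞ c) {x₀ : X} {t : ℝ}
    (ht : c t ∈ (chartAt (EuclideanSpace ℝ (Fin n)) x₀).source) :
    ContDiffAt ℝ ∞ (fun s => extChartAt (𝓡 n) x₀ (c s)) t :=
  (ContMDiffAt.comp t (contMDiffAt_extChartAt' ht) hc.contMDiffAt).contDiffAt

lemma deriv_extChartAt_comp {c : ℝ → X} (hc : ContMDiff 𝓘(ℝ, ℝ) (𝓡 n) ∞ c) {x₀ : X} {t : ℝ}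
    (ht : c t ∈ (chartAt (EuclideanSpace ℝ (Fin n)) x₀).source) :
    deriv (fun s => extChartAt (𝓡 n) x₀ (c s)) t
      = mfderiv (𝓡 n) (𝓡 n) (extChartAt (𝓡 n) x₀) (c t) (velocity (n := n) c t) := by
  have h := mfderiv_comp t (mdifferentiableAt_extChartAt (I := 𝓡 n) ht)
    ((hc.contMDiffAt (x := t)).mdifferentiableAt (by simp))
  rw [← fderiv_apply_one_eq_deriv, ← mfderiv_eq_fderiv]
  exact DFunLike.congr_fun h (1 : ℝ)

lemma deriv_euclidean_apply {u : ℝ → EuclideanSpace ℝ (Fin n)} {t : ℝ}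
    (hu : DifferentiableAt ℝ u t) (k : Fin n) : deriv (fun s => u s k) t = deriv u t k :=
  ((EuclideanSpace.proj (𝕜 := ℝ) k).hasFDerivAt.comp_hasDerivAt t hu.hasDerivAt).deriv

variable [RiemannianBundle (fun x : X => TangentSpace (𝓡 n) x)]

/-- The geodesic equation in the chart at `x₀`, as a first order system for position and velocity:
this vector field on phase space sends `(y, w)` to `(w, -Γ(y)(w, w))`. -/
noncomputable def geodesicField (x₀ : X) (p : EuclideanSpace ℝ (Fin n) × EuclideanSpace ℝ (Fin n)) :
    EuclideanSpace ℝ (Fin n) × EuclideanSpace ℝ (Fin n) :=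
  (p.2, WithLp.toLp 2 fun k => -∑ i, ∑ j, christoffel x₀ k i j p.1 * p.2 i * p.2 j)

lemma IsUnitSpeedGeodesic.hasDerivAt_phase {c : ℝ → X} (hc : IsUnitSpeedGeodesic n c) {x₀ : X}
    {t : ℝ} (ht : c t ∈ (chartAt (EuclideanSpace ℝ (Fin n)) x₀).source) :
    HasDerivAt
      (fun s => (extChartAt (𝓡 n) x₀ (c s), deriv (fun r => extChartAt (𝓡 n) x₀ (c r)) s))
      (geodesicField x₀ (extChartAt (𝓡 n) x₀ (c t), deriv (fun r => extChartAt (𝓡 n) x₀ (c r)) t))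
      t := by
  set u := fun s => extChartAt (𝓡 n) x₀ (c s) with hu
  have hsmooth : ∀ᶠ s in 𝓝 t, DifferentiableAt ℝ u s := by
    filter_upwards [hc.smooth.continuous.continuousAt.preimage_mem_nhds
      ((chartAt (EuclideanSpace ℝ (Fin n)) x₀).open_source.mem_nhds ht)] with s hs
    exact (contDiffAt_extChartAt_comp hc.smooth hs).differentiableAt (by simp)
  have hu2 : DifferentiableAt ℝ (deriv u) t := by
    have h := (contDiffAt_extChartAt_comp hc.smooth ht).fderiv_right (m := ∞) (by simp)
    exact (h.differentiableAt (by simp)).clm_apply (differentiableAt_const (1 : ℝ))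
  have hcoord : ∀ i, deriv (coordCurve c x₀ i) =ᶠ[𝓝 t] fun s => deriv u s i := fun i => by
    filter_upwards [hsmooth] with s hs
    exact deriv_euclidean_apply hs i
  refine hsmooth.self_of_nhds.hasDerivAt.prodMk ?_
  convert! hu2.hasDerivAt using 1
  ext k
  have hgeo := hc.geodesic_eq x₀ t ht k
  rw [(hcoord k).deriv_eq, deriv_euclidean_apply hu2 k] at hgeo
  simp only [fun i => (hcoord i).self_of_nhds] at hgeo
  exact (eq_neg_of_add_eq_zero_left hgeo).symm

variable [IsContMDiffRiemannianBundle (𝓡 n) ∞ (EuclideanSpace ℝ (Fin n))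
      (fun x : X => TangentSpace (𝓡 n) x)]

lemma contDiffAt_geodesicField (x₀ : X)
    {p : EuclideanSpace ℝ (Fin n) × EuclideanSpace ℝ (Fin n)}
    (hp : p.1 ∈ (extChartAt (𝓡 n) x₀).target) : ContDiffAt ℝ ∞ (geodesicField x₀) p := by
  refine contDiffAt_snd.prodMk (contDiffAt_euclidean.2 fun k => ?_)
  have hw : ∀ i, ContDiffAt ℝ ∞
      (fun q : EuclideanSpace ℝ (Fin n) × EuclideanSpace ℝ (Fin n) => q.2 i) p :=
    fun i => contDiffAt_euclidean.1 contDiffAt_snd i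
  exact (ContDiffAt.sum fun i _ => ContDiffAt.sum fun j _ =>
    (((contDiffAt_christoffel x₀ hp k i j).comp p contDiffAt_fst).mul (hw i)).mul (hw j)).neg

/-- Two geodesics with the same position and velocity at time `t` agree near `t`. -/
lemma IsUnitSpeedGeodesic.eventuallyEq {c₁ c₂ : ℝ → X} (h₁ : IsUnitSpeedGeodesic n c₁)
    (h₂ : IsUnitSpeedGeodesic n c₂) {t : ℝ} (hpos : c₁ t = c₂ t)
    (hvel : deriv (fun s => extChartAt (𝓡 n) (c₁ t) (c₁ s)) t
      = deriv (fun s => extChartAt (𝓡 n) (c₁ t) (c₂ s)) t) : c₁ =ᶠ[𝓝 t] c₂ := by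
  set x₀ := c₁ t with hx₀
  have hs₁ : c₁ t ∈ (chartAt (EuclideanSpace ℝ (Fin n)) x₀).source := mem_chart_source _ _
  have hs₂ : c₂ t ∈ (chartAt (EuclideanSpace ℝ (Fin n)) x₀).source := hpos ▸ hs₁
  obtain ⟨K, s, hs, hK⟩ := ((contDiffAt_geodesicField x₀
    (p := (extChartAt (𝓡 n) x₀ (c₁ t), deriv (fun s => extChartAt (𝓡 n) x₀ (c₁ s)) t))
    ((extChartAt (𝓡 n) x₀).map_source (by simpa using hs₁))).of_le
      (m := 1) (by simp)).exists_lipschitzOnWith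
  have heq : (fun s => (extChartAt (𝓡 n) x₀ (c₁ s), deriv (fun r => extChartAt (𝓡 n) x₀ (c₁ r)) s))
      t = (fun s => (extChartAt (𝓡 n) x₀ (c₂ s), deriv (fun r => extChartAt (𝓡 n) x₀ (c₂ r)) s))
      t := Prod.ext (congrArg (extChartAt (𝓡 n) x₀) hpos) hvel
  have hsrc : ∀ {c : ℝ → X}, IsUnitSpeedGeodesic n c →
      c t ∈ (chartAt (EuclideanSpace ℝ (Fin n)) x₀).source →
      ∀ᶠ r in 𝓝 t, c r ∈ (chartAt (EuclideanSpace ℝ (Fin n)) x₀).source := fun h hc =>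
    h.smooth.continuous.continuousAt.preimage_mem_nhds
      ((chartAt (EuclideanSpace ℝ (Fin n)) x₀).open_source.mem_nhds hc)
  have hode := ODE_solution_unique_of_eventually (v := fun _ => geodesicField x₀) (s := fun _ => s)
    (Eventually.of_forall fun _ => hK)
    (((hsrc h₁ hs₁).mono fun r hr => h₁.hasDerivAt_phase hr).and
      ((h₁.hasDerivAt_phase hs₁).continuousAt.preimage_mem_nhds hs))
    (((hsrc h₂ hs₂).mono fun r hr => h₂.hasDerivAt_phase hr).and
      ((h₂.hasDerivAt_phase hs₂).continuousAt.preimage_mem_nhds (Eq.subst (motive := fun z => s ∈ 𝓝 z) heq hs))) heq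
  filter_upwards [hode, hsrc h₁ hs₁, hsrc h₂ hs₂] with r hr hr₁ hr₂
  exact (extChartAt (𝓡 n) x₀).injOn (by simpa using hr₁) (by simpa using hr₂)
    (congrArg Prod.fst hr)

/-- A geodesic is determined by its initial vector. -/
theorem IsUnitSpeedGeodesic.eq_of_tangent_eq [T2Space X] {c₁ c₂ : ℝ → X}
    (h₁ : IsUnitSpeedGeodesic n c₁) (h₂ : IsUnitSpeedGeodesic n c₂)
    (h0 : h₁.tangent 0 = h₂.tangent 0) : c₁ = c₂ := by
  set S : Set ℝ := {t | c₁ =ᶠ[𝓝 t] c₂} with hS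
  have hopen : IsOpen S := isOpen_setOfPred_eventually_nhds
  have hclosed : IsClosed S := by
    refine isClosed_of_closure_subset fun t ht => ?_
    have hpos : c₁ t = c₂ t :=
      closure_minimal (fun s (hs : c₁ =ᶠ[𝓝 s] c₂) => hs.self_of_nhds)
        (isClosed_eq h₁.smooth.continuous h₂.smooth.continuous) ht
    have hs₁ : c₁ t ∈ (chartAt (EuclideanSpace ℝ (Fin n)) (c₁ t)).source := mem_chart_source _ _
    refine h₁.eventuallyEq h₂ hpos ?_
    -- Both coordinate velocities are continuous at `t`, and they agree on `S`.
    have hcont₁ := (h₁.hasDerivAt_phase hs₁).continuousAt.snd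
    have hcont₂ := (h₂.hasDerivAt_phase (x₀ := c₁ t) (t := t) (by rw [← hpos]; exact hs₁)).continuousAt.snd
    have : (𝓝[S] t).NeBot := mem_closure_iff_nhdsWithin_neBot.1 ht
    refine tendsto_nhds_unique (hcont₁.mono_left (nhdsWithin_le_nhds (s := S)))
      ((hcont₂.mono_left nhdsWithin_le_nhds).congr' ?_)
    filter_upwards [self_mem_nhdsWithin] with s (hs : c₁ =ᶠ[𝓝 s] c₂)
    exact (hs.fun_comp (extChartAt (𝓡 n) (c₁ t))).deriv_eq.symm
  have hmem : (0 : ℝ) ∈ S := by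
    have hT : (⟨c₁ 0, velocity c₁ 0⟩ : TangentBundle (𝓡 n) X) = ⟨c₂ 0, velocity c₂ 0⟩ :=
      congrArg Subtype.val h0
    have hpos : c₁ 0 = c₂ 0 := congrArg (fun p : TangentBundle (𝓡 n) X => p.1) hT
    have hs₁ : c₁ 0 ∈ (chartAt (EuclideanSpace ℝ (Fin n)) (c₁ 0)).source := mem_chart_source _ _
    refine h₁.eventuallyEq h₂ hpos ?_
    rw [deriv_extChartAt_comp h₁.smooth hs₁, deriv_extChartAt_comp h₂.smooth (by rw [← hpos]; exact hs₁)]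
    exact congrArg (fun p : TangentBundle (𝓡 n) X =>
      (show EuclideanSpace ℝ (Fin n) from
        mfderiv (𝓡 n) (𝓡 n) (extChartAt (𝓡 n) (c₁ 0)) p.1 p.2)) hT
  have huniv : S = univ := IsClopen.eq_univ ⟨hclosed, hopen⟩ ⟨0, hmem⟩
  funext t
  have ht : t ∈ S := huniv ▸ mem_univ t
  exact EventuallyEq.eq_of_nhds ht

end Geodesics
/-! ### The geodesic flow is an action of `ℝ` -/

section Flow

variable {n : ℕ} {X : Type*} [TopologicalSpace X] [ChartedSpace (EuclideanSpace ℝ (Fin n)) X]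
  [RiemannianBundle (fun x : X => TangentSpace (𝓡 n) x)]

lemma IsUnitSpeedGeodesic.comp_add {c : ℝ → X} (hc : IsUnitSpeedGeodesic n c) (s : ℝ) :
    IsUnitSpeedGeodesic n (fun r => c (r + s)) where
  smooth := hc.smooth.comp (contDiff_id.add contDiff_const).contMDiff
  unit_speed t := by
    rw [velocity_comp_add hc.smooth]
    exact hc.unit_speed (t + s)
  geodesic_eq x₀ t ht k := by
    have h1 : ∀ i, deriv (coordCurve (n := n) (fun r => c (r + s)) x₀ i)
        = fun r => deriv (coordCurve c x₀ i) (r + s) := fun i =>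
      funext fun r => deriv_comp_add_const (coordCurve c x₀ i) s r
    simp only [h1, deriv_comp_add_const (deriv (coordCurve c x₀ k)) s t]
    exact hc.geodesic_eq x₀ (t + s) ht k

lemma IsUnitSpeedGeodesic.tangent_comp_add {c : ℝ → X} (hc : IsUnitSpeedGeodesic n c) (s t : ℝ) :
    (hc.comp_add s).tangent t = hc.tangent (t + s) :=
  Subtype.ext (congrArg (TotalSpace.mk (c (t + s))) (velocity_comp_add hc.smooth s t))

/-- A vector that is not tangent to a complete geodesic is a fixed point of `geodesicFlow`, so that
such vectors do not disturb the group law. -/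
lemma geodesicFlow_of_not_exists {v : UnitTangent n X}
    (hv : ¬∃ c : ℝ → X, ∃ hc : IsUnitSpeedGeodesic n c, hc.tangent 0 = v) (t : ℝ) :
    geodesicFlow t v = v :=
  dif_neg hv

variable [T2Space X] [IsManifold (𝓡 n) ∞ X]
  [IsContMDiffRiemannianBundle (𝓡 n) ∞ (EuclideanSpace ℝ (Fin n))
      (fun x : X => TangentSpace (𝓡 n) x)]

lemma geodesicFlow_tangent {c : ℝ → X} (hc : IsUnitSpeedGeodesic n c) (s t : ℝ) :
    geodesicFlow t (hc.tangent s) = hc.tangent (t + s) := by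
  have h : ∃ c' : ℝ → X, ∃ hc' : IsUnitSpeedGeodesic n c', hc'.tangent 0 = hc.tangent s :=
    ⟨_, hc.comp_add s, by rw [hc.tangent_comp_add, zero_add]⟩
  -- Any geodesic that the definition of the flow may choose is the translate of `c`.
  have key : ∀ (c' : ℝ → X) (hc' : IsUnitSpeedGeodesic n c'), hc'.tangent 0 = hc.tangent s →
      hc'.tangent t = hc.tangent (t + s) := fun c' hc' h' => by
    obtain rfl : c' = fun r => c (r + s) := hc'.eq_of_tangent_eq (hc.comp_add s)
      (by rw [h', hc.tangent_comp_add, zero_add])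
    exact hc.tangent_comp_add s t
  rw [geodesicFlow, dif_pos h]
  exact key _ _ h.choose_spec.choose_spec

lemma geodesicFlow_zero (v : UnitTangent n X) : geodesicFlow 0 v = v := by
  by_cases hv : ∃ c : ℝ → X, ∃ hc : IsUnitSpeedGeodesic n c, hc.tangent 0 = v
  · obtain ⟨c, hc, rfl⟩ := hv
    rw [geodesicFlow_tangent, add_zero]
  · exact geodesicFlow_of_not_exists hv 0

lemma geodesicFlow_add (s t : ℝ) (v : UnitTangent n X) :
    geodesicFlow (s + t) v = geodesicFlow s (geodesicFlow t v) := by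
  by_cases hv : ∃ c : ℝ → X, ∃ hc : IsUnitSpeedGeodesic n c, hc.tangent 0 = v
  · obtain ⟨c, hc, rfl⟩ := hv
    simp only [geodesicFlow_tangent, add_zero]
  · simp only [geodesicFlow_of_not_exists hv]

/-- The flow line through a unit vector. -/
def flowLine (v : UnitTangent n X) : FlowLine n X := Quot.mk _ v

lemma flowLine_eq_iff {v w : UnitTangent n X} :
    flowLine v = flowLine w ↔ ∃ t, geodesicFlow t v = w := by
  have heqv : Equivalence fun v w : UnitTangent n X => ∃ t : ℝ, geodesicFlow t v = w :=
    { refl := fun v => ⟨0, geodesicFlow_zero v⟩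
      symm := fun {v w} ⟨t, ht⟩ => ⟨-t, by
        rw [← ht, ← geodesicFlow_add, neg_add_cancel, geodesicFlow_zero]⟩
      trans := fun {u v w} ⟨s, hs⟩ ⟨t, ht⟩ => ⟨t + s, by rw [geodesicFlow_add, hs, ht]⟩ }
  exact ⟨fun h => heqv.eqvGen_iff.1 (Quot.eqvGen_exact h), fun h => Quot.sound h⟩

/-- The time integral along a flow line can be computed from any of its points. -/
lemma lintegral_flowLine (F : UnitTangent n X → ℝ≥0∞) (w : UnitTangent n X) :
    ∫⁻ t : ℝ, F (geodesicFlow t (Quot.out (flowLine w))) = ∫⁻ t : ℝ, F (geodesicFlow t w) := by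
  obtain ⟨s, hs⟩ := flowLine_eq_iff.1 (Quot.out_eq (flowLine w))
  rw [← lintegral_add_right_eq_self (μ := volume)
    (fun t => F (geodesicFlow t (Quot.out (flowLine w)))) s]
  simp only [geodesicFlow_add, hs]

lemma flowLine_geodesicFlow (t : ℝ) (w : UnitTangent n X) :
    flowLine (geodesicFlow t w) = flowLine w :=
  (flowLine_eq_iff.2 ⟨t, rfl⟩).symm

/-- A bijection between two sets of unit vectors that respects the flow direction preserves sums,
over all flow lines, of time integrals of functions supported on these sets. -/
theorem tsum_lintegral_flowLine_eq {B B' : Set (UnitTangent n X)}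
    {H : UnitTangent n X → UnitTangent n X} (hH : BijOn H B B')
    (hflow : RespectsFlow geodesicFlow H B) {F F' : UnitTangent n X → ℝ≥0∞}
    (hF : ∀ w ∉ B, F w = 0) (hF' : ∀ w ∉ B', F' w = 0) (hFF' : ∀ w ∈ B, F' (H w) = F w) :
    ∑' l : FlowLine n X, ∫⁻ t : ℝ, F (geodesicFlow t (Quot.out l))
      = ∑' l : FlowLine n X, ∫⁻ t : ℝ, F' (geodesicFlow t (Quot.out l)) := by
  have hint : ∀ w ∈ B, ∫⁻ t : ℝ, F' (geodesicFlow t (Quot.out (flowLine (H w))))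
      = ∫⁻ t : ℝ, F (geodesicFlow t (Quot.out (flowLine w))) := fun w hw => by
    simp only [lintegral_flowLine]
    refine lintegral_congr fun t => ?_
    by_cases hB : geodesicFlow t w ∈ B
    · rw [← (hflow w hw _ hB t).1 rfl, hFF' _ hB]
    · rw [hF _ hB]
      -- If `g^t (H w)` lies in `B'`, it is `H w₁` with `w₁ ∈ B`, and then `w₁ = g^t w` lies in `B`.
      refine hF' _ fun hB' => ?_
      obtain ⟨w₁, hw₁, hw₁'⟩ := hH.surjOn hB'
      exact hB ((hflow w hw w₁ hw₁ t).2 hw₁' ▸ hw₁)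
  have hline : ∀ w₁ ∈ B, ∀ w₂ ∈ B,
      (flowLine w₁ = flowLine w₂ ↔ flowLine (H w₁) = flowLine (H w₂)) := fun w₁ h₁ w₂ h₂ => by
    simp only [flowLine_eq_iff]
    exact exists_congr fun t => eq_comm.trans ((hflow w₁ h₁ w₂ h₂ t).trans eq_comm)
  -- A flow line with a nonzero integral meets the set that supports the integrand.
  have hmeet : ∀ {C : Set (UnitTangent n X)} {G : UnitTangent n X → ℝ≥0∞}, (∀ w ∉ C, G w = 0) →
      ∀ l : FlowLine n X, ∫⁻ t : ℝ, G (geodesicFlow t (Quot.out l)) ≠ 0 →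
      ∃ w ∈ C, flowLine w = l := fun {C G} hG l hl => by
    by_contra! hne
    refine hl ?_
    rw [lintegral_congr fun t => hG _ fun hmem => hne _ hmem ?_, lintegral_zero]
    exact (flowLine_geodesicFlow t _).trans (Quot.out_eq l)
  choose w hwB hwl using fun l : Function.support
    (fun l : FlowLine n X => ∫⁻ t : ℝ, F (geodesicFlow t (Quot.out l))) => hmeet hF l.1 l.2
  refine (tsum_eq_tsum_of_ne_zero_bij (fun l => flowLine (H (w l))) ?_ ?_ ?_).symm
  · intro l₁ l₂ hl
    have := (hline _ (hwB l₁) _ (hwB l₂)).2 hl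
    rw [hwl, hwl] at this
    exact Subtype.ext this
  · intro l' hl'
    obtain ⟨w', hw', rfl⟩ := hmeet hF' l' hl'
    obtain ⟨w₁, hw₁, rfl⟩ := hH.surjOn hw'
    have hsupp : flowLine w₁ ∈ Function.support
        (fun l : FlowLine n X => ∫⁻ t : ℝ, F (geodesicFlow t (Quot.out l))) := by
      rw [Function.mem_support, ← hint w₁ hw₁]
      exact hl'
    exact ⟨⟨_, hsupp⟩, (hline _ (hwB _) _ hw₁).1 (hwl _)⟩
  · intro l
    simp only [hint _ (hwB l), hwl]

end Flow

/-! ### Busemann functions and the density -/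

/-- The cocycle identity of a continuous function extends from a dense set of points. -/
lemma cocycle_of_dense {X : Type*} [TopologicalSpace X] {b : X → X → ℝ}
    (hb : Continuous fun x : X × X => b x.1 x.2) {h : ℝ} {D : Set X} (hD : Dense D)
    (hξ : ∀ p ∈ D, ∀ q ∈ D, ∀ r ∈ D, h * b p r = h * (b p q + b q r)) (p q r : X) :
    h * b p r = h * (b p q + b q r) := by
  have hpr : Continuous fun x : X × X × X => b x.1 x.2.2 :=
    hb.comp (continuous_fst.prodMk (continuous_snd.comp continuous_snd))
  have hpq : Continuous fun x : X × X × X => b x.1 x.2.1 :=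
    hb.comp (continuous_fst.prodMk (continuous_fst.comp continuous_snd))
  have hqr : Continuous fun x : X × X × X => b x.2.1 x.2.2 := hb.comp continuous_snd
  have heq := (hpr.const_mul h).ext_on (hD.prod (hD.prod hD)) ((hpq.add hqr).const_mul h)
    fun x hx => hξ x.1 hx.1 x.2.1 hx.2.1 x.2.2 hx.2.2
  exact congrFun heq (p, q, r)

section Busemann

variable {n : ℕ} {X : Type*} [MetricSpace X] [ChartedSpace (EuclideanSpace ℝ (Fin n)) X]
  [RiemannianBundle (fun x : X => TangentSpace (𝓡 n) x)]

/-- The Busemann function is 1-Lipschitz in each base point. The functions under the `limsup` are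
bounded by the triangle inequality, whether or not they converge. -/
lemma busemann_le_add (p q p' q' : X) (ξ : Boundary n X) :
    busemann p q ξ ≤ busemann p' q' ξ + (dist p p' + dist q q') := by
  set c := fun t : ℝ => (geodesicFlow t (Quotient.out ξ)).base
  have hbdd : ∀ a b : X, IsBoundedUnder (· ≤ ·) atTop fun t => dist b (c t) - dist a (c t) :=
    fun a b => isBoundedUnder_of ⟨dist a b, fun t => by
      linarith [dist_triangle_left b (c t) a]⟩
  have hcobdd : ∀ a b : X, IsCoboundedUnder (· ≤ ·) atTop fun t => dist b (c t) - dist a (c t) :=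
    fun a b => IsBoundedUnder.isCoboundedUnder_le (isBoundedUnder_of ⟨-dist a b, fun t => by
      linarith [dist_triangle a b (c t)]⟩)
  calc busemann p q ξ
      ≤ limsup (fun t => (dist q' (c t) - dist p' (c t)) + (dist p p' + dist q q')) atTop := by
        refine limsup_le_limsup (Eventually.of_forall fun t => ?_) (hcobdd p q) ?_
        · show dist q (c t) - dist p (c t) ≤ _
          linarith [dist_triangle q q' (c t), dist_triangle_left p' (c t) p]
        · exact isBoundedUnder_of ⟨dist p' q' + (dist p p' + dist q q'), fun t => by
            linarith [dist_triangle_left q' (c t) p']⟩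
    _ = _ := limsup_add_const atTop _ _ (hbdd p' q') (hcobdd p' q')

/-- The Busemann function depends continuously on the two base points. -/
lemma continuous_busemann (ξ : Boundary n X) :
    Continuous fun x : X × X => busemann x.1 x.2 ξ := by
  refine (LipschitzWith.of_le_add_mul 2 fun x y => ?_).continuous
  have h1 : dist x.1 y.1 ≤ dist x y := le_max_left _ _
  have h2 : dist x.2 y.2 ≤ dist x y := le_max_right _ _
  refine (busemann_le_add x.1 x.2 y.1 y.2 ξ).trans ?_
  push_cast
  linarith

/-- The weight `e^{-h b(p, w, ξ)}` changes under a change of base point by the density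
`dμ_{p'}/dμ_p`, and it does not change if `w` moves along a horosphere. -/
lemma weight_eq_mul_weight {h : ℝ} {ξ : Boundary n X} (hξ : ∀ p q r : X,
      h * busemann p r ξ = h * (busemann p q ξ + busemann q r ξ)) (p p' : X) {x x' : X}
    (hx : busemann x x' ξ = 0) :
    ENNReal.ofReal (Real.exp (-h * busemann p x ξ))
      = ENNReal.ofReal (Real.exp (-h * busemann p p' ξ))
        * ENNReal.ofReal (Real.exp (-h * busemann p' x' ξ)) := by
  rw [← ENNReal.ofReal_mul (Real.exp_pos _).le, ← Real.exp_add]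
  congr 2
  have h1 := hξ p x x'
  have h2 := hξ p p' x'
  rw [hx] at h1
  linarith

variable [IsManifold (𝓡 n) 1 X] {M : Type*} {proj : X → M} {h : ℝ}
  {μ : X → Measure (Boundary n X)}

lemma IsBusemannDensity.ae_cocycle_of_points (hμ : IsBusemannDensity proj h μ) (o p q r : X) :
    ∀ᵐ ξ ∂μ o, h * busemann p r ξ = h * (busemann p q ξ + busemann q r ξ) := by
  have := hμ.finite
  have hchain := Measure.rnDeriv_mul_rnDeriv (κ := μ p) (hμ.absolutelyContinuous r q)
  filter_upwards [hμ.absolutelyContinuous o p hchain,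
    hμ.absolutelyContinuous o q (hμ.rnDeriv_eq r q),
    hμ.absolutelyContinuous o p (hμ.rnDeriv_eq q p),
    hμ.absolutelyContinuous o p (hμ.rnDeriv_eq r p)] with ξ hξ hrq hqp hrp
  rw [Pi.mul_apply, hrq, hqp, hrp, ← ENNReal.ofReal_mul (Real.exp_pos _).le, ← Real.exp_add,
    ENNReal.ofReal_eq_ofReal_iff (Real.exp_pos _).le (Real.exp_pos _).le, Real.exp_eq_exp] at hξ
  linarith

/-- Since Radon–Nikodym derivatives satisfy the chain rule, a Busemann density forces the cocycle
identity of the Busemann functions for almost every boundary point. The exceptional null set can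
be chosen independently of the base points, since the latter can be restricted to a countable dense
set by continuity. The factor `h` accounts for `h = 0`, when the density carries no information. -/
theorem IsBusemannDensity.ae_cocycle [SecondCountableTopology X]
    (hμ : IsBusemannDensity proj h μ) (o : X) :
    ∀ᵐ ξ ∂μ o, ∀ p q r : X,
      h * busemann p r ξ = h * (busemann p q ξ + busemann q r ξ) := by
  obtain ⟨D, hDc, hD⟩ := TopologicalSpace.exists_countable_dense X
  have hae : ∀ᵐ ξ ∂μ o, ∀ p ∈ D, ∀ q ∈ D, ∀ r ∈ D,
      h * busemann p r ξ = h * (busemann p q ξ + busemann q r ξ) :=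
    (ae_ball_iff hDc).2 fun p _ => (ae_ball_iff hDc).2 fun q _ => (ae_ball_iff hDc).2 fun r _ =>
      hμ.ae_cocycle_of_points o p q r
  exact hae.mono fun ξ hξ =>
    cocycle_of_dense (b := fun p q => busemann p q ξ) (continuous_busemann ξ) hD hξ

/-- Change of base point; the integrand need not be measurable. -/
lemma IsBusemannDensity.lintegral_eq (hμ : IsBusemannDensity proj h μ) (p q : X)
    (F : Boundary n X → ℝ≥0∞) :
    ∫⁻ ξ, F ξ ∂μ q = ∫⁻ ξ, ENNReal.ofReal (Real.exp (-h * busemann p q ξ)) * F ξ ∂μ p := by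
  have := hμ.finite
  conv_lhs => rw [← Measure.withDensity_rnDeriv_eq _ _ (hμ.absolutelyContinuous q p)]
  rw [lintegral_withDensity_eq_lintegral_mul_non_measurable _ (Measure.measurable_rnDeriv _ _)
    (Measure.rnDeriv_lt_top _ _)]
  refine lintegral_congr_ae ?_
  filter_upwards [hμ.rnDeriv_eq q p] with ξ hξ
  rw [Pi.mul_apply, hξ]

/-! ### Holonomy invariance -/

lemma bijOn_fiber {S T : Type*} {H : S → S} {A A' : Set S} (hH : BijOn H A A') {e : S → T}
    (he : ∀ w ∈ A, e (H w) = e w) (ξ : T) :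
    BijOn H {w | w ∈ A ∧ e w = ξ} {w | w ∈ A' ∧ e w = ξ} := by
  refine ⟨fun w hw => ⟨hH.mapsTo hw.1, (he w hw.1).trans hw.2⟩,
    hH.injOn.mono fun w hw => hw.1, fun w' hw' => ?_⟩
  obtain ⟨w, hw, rfl⟩ := hH.surjOn hw'.1
  exact ⟨w, ⟨hw, (he w hw).symm.trans hw'.2⟩, rfl⟩

variable [SecondCountableTopology X]

/-- The conditionals agree on two sets matched by a bijection that preserves the endpoint `e` and
the horospheres at that endpoint. -/
theorem condMeasure_eq_of_bijOn (hμ : IsBusemannDensity proj h μ)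
    {e : UnitTangent n X → Boundary n X} {H : UnitTangent n X → UnitTangent n X}
    {A A' : Set (UnitTangent n X)} (hH : BijOn H A A') (he : ∀ w ∈ A, e (H w) = e w)
    (hb : ∀ w ∈ A, busemann w.base (H w).base (e w) = 0) (v v' : UnitTangent n X) :
    condMeasure e h μ v A = condMeasure e h μ v' A' := by
  rw [condMeasure, condMeasure, hμ.lintegral_eq v.base v'.base]
  refine lintegral_congr_ae ?_
  filter_upwards [hμ.ae_cocycle v.base] with ξ hξ
  let E : {w // w ∈ A ∧ e w = ξ} ≃ {w // w ∈ A' ∧ e w = ξ} := (bijOn_fiber hH he ξ).equiv H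
  rw [← ENNReal.tsum_mul_left, ← E.tsum_eq]
  refine tsum_congr fun w => weight_eq_mul_weight hξ _ _ ?_
  obtain ⟨w, hw, rfl⟩ := w
  exact hb w hw

end Busemann

section HolonomyFlow

variable {n : ℕ} {X : Type*} [MetricSpace X] [SecondCountableTopology X]
  [ChartedSpace (EuclideanSpace ℝ (Fin n)) X] [IsManifold (𝓡 n) ∞ X]
  [RiemannianBundle (fun x : X => TangentSpace (𝓡 n) x)]
  [IsContMDiffRiemannianBundle (𝓡 n) ∞ (EuclideanSpace ℝ (Fin n))
      (fun x : X => TangentSpace (𝓡 n) x)]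
  {M : Type*} {proj : X → M} {h : ℝ} {μ : X → Measure (Boundary n X)}

/-- The analogue of `condMeasure_eq_of_bijOn` for the conditionals on weak leaves. -/
theorem condMeasureFlow_eq_of_bijOn (hμ : IsBusemannDensity proj h μ)
    {e : UnitTangent n X → Boundary n X} {H : UnitTangent n X → UnitTangent n X}
    {A A' : Set (UnitTangent n X)} (hH : BijOn H A A') (he : ∀ w ∈ A, e (H w) = e w)
    (hb : ∀ w ∈ A, busemann w.base (H w).base (e w) = 0) (hflow : RespectsFlow geodesicFlow H A)
    (v v' : UnitTangent n X) :
    condMeasureFlow e h μ v A = condMeasureFlow e h μ v' A' := by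
  rw [condMeasureFlow, condMeasureFlow, hμ.lintegral_eq v.base v'.base]
  refine lintegral_congr_ae ?_
  filter_upwards [hμ.ae_cocycle v.base] with ξ hξ
  rw [← ENNReal.tsum_mul_left]
  simp only [← lintegral_const_mul' _ _ ENNReal.ofReal_ne_top]
  have hfib := bijOn_fiber hH he ξ
  refine tsum_lintegral_flowLine_eq hfib
    (fun w₁ h₁ w₂ h₂ t => hflow w₁ h₁.1 w₂ h₂.1 t) (fun w hw => indicator_of_notMem hw _)
    (F' := fun w => _ * indicator _ _ w)
    (fun w hw => by rw [indicator_of_notMem hw, mul_zero]) fun w hw => ?_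
  rw [indicator_of_mem hw, indicator_of_mem (hfib.mapsTo hw)]
  exact (weight_eq_mul_weight hξ _ _ (hw.2 ▸ hb w hw.1)).symm

end HolonomyFlow

end RankOne

theorem mainTheorem3 (n : ℕ)
    -- the compact rank one manifold `M` of nonpositive curvature
    {M : Type*} [TopologicalSpace M] [T2Space M] [CompactSpace M] [ConnectedSpace M]
    [ChartedSpace (EuclideanSpace ℝ (Fin n)) M] [IsManifold (𝓡 n) ∞ M]
    [RiemannianBundle (fun x : M => TangentSpace (𝓡 n) x)]
    [IsContMDiffRiemannianBundle (𝓡 n) ∞ (EuclideanSpace ℝ (Fin n))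
      (fun x : M => TangentSpace (𝓡 n) x)]
    (hcurv : RankOne.NonposCurvature n M) (hrank : RankOne.IsRankOne n M)
    -- its universal covering `X`, with the Riemannian distance
    {X : Type*} [MetricSpace X] [SecondCountableTopology X] [SimplyConnectedSpace X]
    [ChartedSpace (EuclideanSpace ℝ (Fin n)) X] [IsManifold (𝓡 n) ∞ X]
    [RiemannianBundle (fun x : X => TangentSpace (𝓡 n) x)]
    [IsContMDiffRiemannianBundle (𝓡 n) ∞ (EuclideanSpace ℝ (Fin n))
      (fun x : X => TangentSpace (𝓡 n) x)]
    [IsRiemannianManifold (𝓡 n) X]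
    (proj : X → M) (hproj : RankOne.IsRiemannianCovering n proj)
    -- the Busemann density
    (h : ℝ) (μ : X → MeasureTheory.Measure (RankOne.Boundary n X))
    (hμ : RankOne.IsBusemannDensity proj h μ) :
    -- invariance of the unstable conditionals under stable holonomy
    (∀ v v' : RankOne.UnitTangent n X, v' ∈ RankOne.stableLeaf v →
      ∀ (A A' : Set (RankOne.UnitTangent n X))
        (H : RankOne.UnitTangent n X → RankOne.UnitTangent n X),
        A ⊆ RankOne.weakUnstableLeaf v → A' ⊆ RankOne.weakUnstableLeaf v' →
        RankOne.IsHolonomy RankOne.stableLeaf H A A' →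
        RankOne.mU h μ v A = RankOne.mU h μ v' A' ∧
        (RankOne.RespectsFlow RankOne.geodesicFlow H A →
          RankOne.mWeakU h μ v A = RankOne.mWeakU h μ v' A')) ∧
    -- invariance of the stable conditionals under unstable holonomy
    (∀ v v' : RankOne.UnitTangent n X, v' ∈ RankOne.unstableLeaf v →
      ∀ (A A' : Set (RankOne.UnitTangent n X))
        (H : RankOne.UnitTangent n X → RankOne.UnitTangent n X),
        A ⊆ RankOne.weakStableLeaf v → A' ⊆ RankOne.weakStableLeaf v' →
        RankOne.IsHolonomy RankOne.unstableLeaf H A A' →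
        RankOne.mS h μ v A = RankOne.mS h μ v' A' ∧
        (RankOne.RespectsFlow RankOne.geodesicFlow H A →
          RankOne.mWeakS h μ v A = RankOne.mWeakS h μ v' A')) := by
  refine ⟨fun v v' _ A A' H _ _ hH => ?_, fun v v' _ A A' H _ _ hH => ?_⟩
  · have he : ∀ w ∈ A, RankOne.endpointPlus (H w) = RankOne.endpointPlus w :=
      fun w hw => Quotient.sound (hH.mem_leaf w hw).1
    have hb := fun w hw => (hH.mem_leaf w hw).2
    exact ⟨RankOne.condMeasure_eq_of_bijOn hμ hH.bijOn he hb v v',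
      fun hflow => RankOne.condMeasureFlow_eq_of_bijOn hμ hH.bijOn he hb hflow v v'⟩
  · have he : ∀ w ∈ A, RankOne.endpointMinus (H w) = RankOne.endpointMinus w :=
      fun w hw => Quotient.sound (hH.mem_leaf w hw).1
    have hb := fun w hw => (hH.mem_leaf w hw).2
    exact ⟨RankOne.condMeasure_eq_of_bijOn hμ hH.bijOn he hb v v',
      fun hflow => RankOne.condMeasureFlow_eq_of_bijOn hμ hH.bijOn he hb hflow v v'⟩
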